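/- Let $M$ be a topological space (in particular, any smooth manifold). For an abelian group $A$ let $\check H^k(M;A)$ denote the $k$-th Čech cohomology group of $M$ with coefficients in the constant sheaf $A$ (whose sections over an open set are the locally constant $A$-valued functions), i.e. the direct limit, over the open covers of $M$ ordered by refinement, of the Čech cohomology groups of the covers. The sequence of constant sheaves $$0\to\mathbb Z\xrightarrow{\ k\mapsto 2\pi k\ }\mathbb R\xrightarrow{\ a\mapsto e^{ia}\ }S^1\to 1$$ is exact (as the sequence of groups is), and there is a unique homomorphism $\delta:\check H^1(M;S^1)\to\check H^2(M;\mathbb Z)$ that is its connecting homomorphism: if a cocycle $c$ with values in $S^1$ on an open cover is the image of a cochain $b$ with values in $\mathbb R$, and $a$ is the $\mathbb Z$-valued cocycle with $2\pi a=db$, then $\delta[c]=[a]$. With the other maps induced by the homomorphisms of coefficients, the sequence $$0\to\check H^1(M;\mathbb Z)\to\check H^1(M;\mathbb R)\to\check H^1(M;S^1)\xrightarrow{\ \delta\ }\check H^2(M;\mathbb Z)\to\check H^2(M;\mathbb R)$$ is exact. Consequently, $a\mapsto e^{ia}$ and $\delta$ induce a short exact sequence of groups $$0\to\check H^1(M;\mathbb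 R)/\check H^1(M;\mathbb Z)\to\check H^1(M;S^1)\to\ker\{\check H^2(M;\mathbb Z)\to\check H^2(M;\mathbb R)\}\to 0,$$ where $\check H^1(M;\mathbb Z)$ is identified with its image in $\check H^1(M;\mathbb R)$ under the injective map above. The kernel on the right is the same whether $\mathbb Z\to\mathbb R$ is $k\mapsto 2\pi k$ or the inclusion $k\mapsto k$. -/

import Mathlib

/-- An open cover of `X` indexed by the points of `X`: an open neighbourhood of every point.
Every open cover `(V i)` of `X` is refined by such a cover (choose for each `x` an index `i x` with
`x ∈ V (i x)`), so these covers are cofinal among all open covers, and the direct limit of the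
cohomology groups over them is the direct limit over all open covers. -/
structure PointedCover (X : Type*) [TopologicalSpace X] where
  /-- the open neighbourhood of a point -/
  nhd : X → TopologicalSpace.Opens X
  mem_nhd : ∀ x, x ∈ nhd x

namespace PointedCover

variable {X : Type*} [TopologicalSpace X]

/-- `U ≤ V` means that `V` is finer than `U`; the refinement map on indices is the identity. -/
instance : Preorder (PointedCover X) where
  le U V := ∀ x, V.nhd x ≤ U.nhd x
  le_refl _ _ := le_rfl
  le_trans _ _ _ h h' x := (h' x).trans (h x)

instance : Nonempty (PointedCover X) := ⟨⟨fun _ => ⊤, fun _ => trivial⟩⟩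

instance : IsDirectedOrder (PointedCover X) where
  directed U V := ⟨⟨fun x => U.nhd x ⊓ V.nhd x, fun x => ⟨U.mem_nhd x, V.mem_nhd x⟩⟩,
    fun _ => inf_le_left, fun _ => inf_le_right⟩

/-- The intersection `U_{i 0} ∩ ⋯ ∩ U_{i n}`. -/
def inter (U : PointedCover X) {n : ℕ} (i : Fin (n + 1) → X) : TopologicalSpace.Opens X :=
  ⟨⋂ j, (U.nhd (i j) : Set X), isOpen_iInter_of_finite fun j => (U.nhd (i j)).isOpen⟩

lemma inter_le_face (U : PointedCover X) {n : ℕ} (i : Fin (n + 2) → X) (j : Fin (n + 2)) :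
    (U.inter i : Set X) ⊆ U.inter (i ∘ j.succAbove) :=
  Set.subset_iInter fun k => Set.iInter_subset (fun l => (U.nhd (i l) : Set X)) (j.succAbove k)

lemma inter_mono {U V : PointedCover X} (h : U ≤ V) {n : ℕ} (i : Fin (n + 1) → X) :
    (V.inter i : Set X) ⊆ U.inter i :=
  Set.iInter_mono fun j => h (i j)

end PointedCover

namespace Cech

/-- Čech `n`-cochains of the cover `U` with coefficients in the constant sheaf `A`, the sheaf whose
sections over an open set are the locally constant `A`-valued functions on it. -/
abbrev Cochain {X : Type*} [TopologicalSpace X] (U : PointedCover X) (A : Type*) (n : ℕ) :=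
  ∀ i : Fin (n + 1) → X, LocallyConstant (U.inter i) A

section

variable {X : Type*} [TopologicalSpace X] (U : PointedCover X) (A : Type*) [AddCommGroup A]

/-- The `j`-th face: `(face j c)_{i 0, …, i (n+1)}` is the restriction of
`c_{i 0, …, (omit i j), …, i (n+1)}` to `U_{i 0} ∩ ⋯ ∩ U_{i (n+1)}`. -/
def face (n : ℕ) (j : Fin (n + 2)) : Cochain U A n →+ Cochain U A (n + 1) where
  toFun c i := (c (i ∘ j.succAbove)).comap (ContinuousMap.inclusion (U.inter_le_face i j))
  map_zero' := rfl
  map_add' _ _ := rfl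

/-- The Čech differential, the alternating sum of the faces. -/
def d (n : ℕ) : Cochain U A n →+ Cochain U A (n + 1) :=
  ∑ j : Fin (n + 2), (-1 : ℤ) ^ (j : ℕ) • face U A n j

/-- The `n`-cocycles. -/
abbrev cocycles (n : ℕ) : AddSubgroup (Cochain U A n) := (d U A n).ker

/-- The `n`-coboundaries. -/
def coboundaries : (n : ℕ) → AddSubgroup (Cochain U A n)
  | 0 => ⊥
  | n + 1 => (d U A n).range

/-- The Čech cohomology of the cover `U`: cocycles modulo coboundaries. -/
def HCover (n : ℕ) := cocycles U A n ⧸ (coboundaries U A n).addSubgroupOf (cocycles U A n)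

instance (n : ℕ) : AddCommGroup (HCover U A n) :=
  inferInstanceAs (AddCommGroup (cocycles U A n ⧸ (coboundaries U A n).addSubgroupOf _))

/-- The class of a cocycle in the cohomology of the cover. -/
def HCover.mk (n : ℕ) : cocycles U A n →+ HCover U A n := QuotientAddGroup.mk' _

end

section

variable {X : Type*} [TopologicalSpace X] {A B : Type*} [AddCommGroup A] [AddCommGroup B]

/-- Homomorphisms `φ n` of cochain groups that commute with the differentials induce
homomorphisms of the cohomology groups of covers. -/
def HCover.lift {U V : PointedCover X} (φ : ∀ n, Cochain U A n →+ Cochain V B n)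
    (hφ : ∀ n c, d V B n (φ n c) = φ (n + 1) (d U A n c)) (n : ℕ) :
    HCover U A n →+ HCover V B n :=
  QuotientAddGroup.map _ _
    (((φ n).comp (cocycles U A n).subtype).codRestrict (cocycles V B n) fun c => by
      have hc : d U A n c = 0 := c.2
      simp [AddMonoidHom.mem_ker, hφ, hc])
    (by
      rintro ⟨c, hc⟩ hb
      rw [AddSubgroup.mem_addSubgroupOf] at hb
      rw [AddSubgroup.mem_comap, AddSubgroup.mem_addSubgroupOf]
      change φ n c ∈ _
      change c ∈ _ at hb
      cases n with
      | zero =>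
        have h0 : c = 0 := hb
        rw [h0, map_zero]
        exact zero_mem _
      | succ n =>
        obtain ⟨b, rfl⟩ := hb
        exact ⟨φ n b, hφ n b⟩)

/-- Restriction of cochains to a finer cover. -/
def resCochain {U V : PointedCover X} (h : U ≤ V) (n : ℕ) : Cochain U A n →+ Cochain V A n where
  toFun c i := (c i).comap (ContinuousMap.inclusion (PointedCover.inter_mono h i))
  map_zero' := rfl
  map_add' _ _ := rfl

/-- Composition of cochains with a homomorphism of coefficient groups. -/
def coeffCochain (U : PointedCover X) (f : A →+ B) (n : ℕ) : Cochain U A n →+ Cochain U B n where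
  toFun c i := (c i).map f
  map_zero' := by ext; simp
  map_add' _ _ := by ext; simp

lemma d_resCochain {U V : PointedCover X} (h : U ≤ V) (n : ℕ) (c : Cochain U A n) :
    d V A n (resCochain h n c) = resCochain h (n + 1) (d U A n c) := by
  simp only [d, AddMonoidHom.finsetSum_apply, map_sum, AddMonoidHom.smul_apply, map_zsmul]
  rfl

lemma d_coeffCochain (U : PointedCover X) (f : A →+ B) (n : ℕ) (c : Cochain U A n) :
    d U B n (coeffCochain U f n c) = coeffCochain U f (n + 1) (d U A n c) := by
  simp only [d, AddMonoidHom.finsetSum_apply, map_sum, AddMonoidHom.smul_apply, map_zsmul]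
  rfl

/-- The restriction homomorphism to a finer cover. -/
def res (A : Type*) [AddCommGroup A] (n : ℕ) (U V : PointedCover X) (h : U ≤ V) :
    HCover U A n →+ HCover V A n :=
  HCover.lift (resCochain h) (d_resCochain h) n

/-- The homomorphism induced by a homomorphism of coefficient groups. -/
def coeff (f : A →+ B) (n : ℕ) (U : PointedCover X) : HCover U A n →+ HCover U B n :=
  HCover.lift (coeffCochain U f) (d_coeffCochain U f) n

lemma coeff_comp_res (f : A →+ B) (n : ℕ) (U V : PointedCover X) (h : U ≤ V) :
    (coeff f n V).comp (res A n U V h) = (res B n U V h).comp (coeff f n U) := by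
  refine DFunLike.ext _ _ fun x => ?_
  induction x using QuotientAddGroup.induction_on
  rfl

end

open scoped Classical in
/-- The Čech cohomology group `Ȟⁿ(X; A)` of `X` with coefficients in the constant sheaf `A`: the
direct limit of the cohomology groups of open covers under refinement. -/
def H (X : Type*) [TopologicalSpace X] (A : Type*) [AddCommGroup A] (n : ℕ) :=
  AddCommGroup.DirectLimit (fun U : PointedCover X => HCover U A n) (res A n)

open scoped Classical in
noncomputable instance (X : Type*) [TopologicalSpace X] (A : Type*) [AddCommGroup A] (n : ℕ) :
    AddCommGroup (H X A n) :=
  inferInstanceAs (AddCommGroup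
    (AddCommGroup.DirectLimit (fun U : PointedCover X => HCover U A n) (res A n)))

section

variable {X : Type*} [TopologicalSpace X] {A B C : Type*} [AddCommGroup A] [AddCommGroup B]
  [AddCommGroup C]

open scoped Classical in
/-- The class in `Ȟⁿ(X; A)` of a cocycle on an open cover. -/
noncomputable def cls {n : ℕ} {U : PointedCover X} (c : cocycles U A n) : H X A n :=
  AddCommGroup.DirectLimit.of (fun U : PointedCover X => HCover U A n) (res A n) U
    (HCover.mk U A n c)

open scoped Classical in
/-- The homomorphism `Ȟⁿ(X; A) → Ȟⁿ(X; B)` induced by a homomorphism `A → B`. -/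
noncomputable def map (X : Type*) [TopologicalSpace X] (f : A →+ B) (n : ℕ) : H X A n →+ H X B n :=
  AddCommGroup.DirectLimit.map (coeff f n) (coeff_comp_res f n)

/-- `δ` is the connecting homomorphism of `A → B → C` (via `f` and `g`): if a cocycle `c` with
values in `C` is lifted to a cochain `b` with values in `B`, and `a` is the cocycle with values in
`A` whose image is the differential of `b`, then `δ` maps the class of `c` to the class of `a`. -/
def IsConnectingHom (f : A →+ B) (g : B →+ C) (n : ℕ) (δ : H X C n →+ H X A (n + 1)) : Prop :=
  ∀ (U : PointedCover X) (b : Cochain U B n) (c : cocycles U C n) (a : cocycles U A (n + 1)),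
    coeffCochain U g n b = c → coeffCochain U f (n + 1) a = d U B n b → δ (cls c) = cls a

end

end Cech

/-- The homomorphism `ℤ → ℝ`, `k ↦ 2 π k`. -/
noncomputable def twoPiInt : ℤ →+ ℝ where
  toFun k := 2 * Real.pi * k
  map_zero' := by simp
  map_add' k l := by push_cast; ring

/-!
For a short exact sequence `0 → A → B → C → 0` of abelian groups, with maps `f` and `g`, the
cochain groups of every open cover form a short exact sequence
(`Cech.coeffCochain_injective`, `Cech.exists_coeffCochain_eq`, `Cech.coeffCochain_surjective`):
the coefficient sheaves are constant, so that a cochain lifts along `g` by composition with a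
set-theoretic section of `g`, on any open set and without passing to a finer cover. With
`d ∘ d = 0` (`Cech.d_d`), the usual diagram chase on a cover gives the connecting homomorphism and
the long exact sequence. The chase is carried out on representatives in the direct limit, where a
cocycle has class zero exactly if it becomes a coboundary on some finer cover
(`Cech.cls_eq_zero_iff`). The key step is `Cech.mem_coboundaries_of_coeffCochain_eq_d`: the class
of `a` with `f a = d b` depends only on the class of the image of `b`.

The long exact sequence starts with `0` in degree one because a `0`-cocycle with values in `C` is a
global locally constant function on `X` and hence lifts to one with values in `B`
(`Cech.mem_coboundaries_one`).

The exponential sequence is the case `A = ℤ`, `B = ℝ`, `C = S¹`. The homomorphisms `k ↦ 2πk` and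
`k ↦ k` differ by multiplication by `2π`, an automorphism of `ℝ`, so they have the same kernel in
cohomology (`Cech.ker_map_comp`).
-/

namespace Cech

/-! ### The short exact sequence of cochain groups -/

section Cochains

/-- The value of a cochain depends only on the multi-index and on the point, not on the proof
that the point lies in the intersection. -/
lemma cochain_apply_congr {X S : Type*} [TopologicalSpace X] (U : PointedCover X) {n : ℕ}
    (c : Cochain U S n) {i i' : Fin (n + 1) → X} (h : i = i') {x : X} (hx : x ∈ U.inter i)
    (hx' : x ∈ U.inter i') :
    c i ⟨x, hx⟩ = c i' ⟨x, hx'⟩ := by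
  subst h
  rfl

variable {X : Type*} [TopologicalSpace X] {A B C : Type*} [AddCommGroup A] [AddCommGroup B]
  [AddCommGroup C]

lemma d_apply (U : PointedCover X) {n : ℕ} (c : Cochain U A n) (i : Fin (n + 2) → X)
    (x : U.inter i) :
    d U A n c i x = ∑ j : Fin (n + 2), (-1 : ℤ) ^ (j : ℕ) •
      c (i ∘ j.succAbove) ⟨x, U.inter_le_face i j x.2⟩ := by
  simp only [d, AddMonoidHom.finsetSum_apply, Finset.sum_apply, AddMonoidHom.smul_apply]
  rw [← LocallyConstant.evalAddMonoidHom_apply x, map_sum]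
  rfl

lemma d_zero_apply (U : PointedCover X) (c : Cochain U A 0) (i : Fin 2 → X) (x : U.inter i) :
    d U A 0 c i x = c (i ∘ Fin.succAbove 0) ⟨x, U.inter_le_face i 0 x.2⟩ -
      c (i ∘ Fin.succAbove 1) ⟨x, U.inter_le_face i 1 x.2⟩ := by
  rw [d_apply, Fin.sum_univ_two]
  simp [sub_eq_add_neg]

/-- The terms of the double sum that omit the same two indices in the two possible orders
cancel. -/
lemma d_d (U : PointedCover X) (n : ℕ) (c : Cochain U A n) :
    d U A (n + 1) (d U A n c) = 0 := by
  funext i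
  ext x
  rw [d_apply]
  simp only [d_apply, Finset.smul_sum, smul_smul, ← pow_add]
  rw [← Finset.sum_product', Finset.univ_product_univ]
  refine Finset.sum_involution (fun p _ => (p.1.succAbove p.2, p.2.predAbove p.1)) ?_ ?_ ?_ ?_
  · rintro ⟨p, q⟩ -
    have key : (i ∘ (p.succAbove q).succAbove) ∘ (q.predAbove p).succAbove
        = (i ∘ p.succAbove) ∘ q.succAbove :=
      funext fun k => congrArg i (Fin.succAbove_succAbove_succAbove_predAbove p q k)
    dsimp only
    rw [cochain_apply_congr U c key _
      (U.inter_le_face _ q (U.inter_le_face i p x.2)), Fin.neg_one_pow_succAbove_add_predAbove,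
      neg_smul, pow_add, add_neg_cancel]
  · rintro ⟨p, q⟩ - - h
    exact Fin.succAbove_ne p q (congrArg Prod.fst h)
  · simp
  · rintro ⟨p, q⟩ -
    simp [Fin.succAbove_succAbove_predAbove, Fin.predAbove_predAbove_succAbove]

lemma coeffCochain_injective (U : PointedCover X) {f : A →+ B} (hf : Function.Injective f)
    (n : ℕ) : Function.Injective (coeffCochain U f n) := fun a a' h => by
  funext i
  ext x
  exact hf (DFunLike.congr_fun (congrFun h i) x)

/-- A locally constant function lifts along any surjection, since composition with a set-theoretic
section is again locally constant. -/
lemma coeffCochain_surjective (U : PointedCover X) {g : B →+ C} (hg : Function.Surjective g)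
    (n : ℕ) : Function.Surjective (coeffCochain U g n) := fun c =>
  ⟨fun i => (c i).map (Function.surjInv hg), by
    funext i
    ext x
    exact Function.surjInv_eq hg _⟩

/-- The exactness of the cochain groups in the middle: a preimage can be chosen pointwise by a
set-theoretic function, which keeps the cochain locally constant. -/
lemma exists_coeffCochain_eq (U : PointedCover X) {f : A →+ B} {g : B →+ C}
    (hfg : Function.Exact f g) {n : ℕ} {b : Cochain U B n} (hb : coeffCochain U g n b = 0) :
    ∃ a, coeffCochain U f n a = b := by
  have h (i) (x) : b i x ∈ Set.range f := (hfg _).1 (DFunLike.congr_fun (congrFun hb i) x)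
  refine ⟨fun i => (b i).map (Function.invFun f), ?_⟩
  funext i
  ext x
  exact Function.invFun_eq (h i x)

lemma coeffCochain_comp_eq_zero (U : PointedCover X) {f : A →+ B} {g : B →+ C}
    (hfg : Function.Exact f g) {n : ℕ} (a : Cochain U A n) :
    coeffCochain U g n (coeffCochain U f n a) = 0 := by
  funext i
  ext x
  exact hfg.apply_apply_eq_zero _

lemma coeffCochain_resCochain {U V : PointedCover X} (h : U ≤ V) (f : A →+ B) (n : ℕ)
    (c : Cochain U A n) :
    coeffCochain V f n (resCochain h n c) = resCochain h n (coeffCochain U f n c) := rfl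

/-- The cocycle with values in `A` that represents the connecting homomorphism is determined up to
coboundaries: if `b` maps to a coboundary, then the cocycle `a` with image `d b` is one. -/
lemma mem_coboundaries_of_coeffCochain_eq_d (U : PointedCover X) {f : A →+ B} {g : B →+ C}
    (hf : Function.Injective f) (hfg : Function.Exact f g) (hg : Function.Surjective g) {n : ℕ}
    {a : Cochain U A (n + 1)} {b : Cochain U B n} (hab : coeffCochain U f (n + 1) a = d U B n b)
    (hb : coeffCochain U g n b ∈ coboundaries U C n) : a ∈ coboundaries U A (n + 1) := by
  suffices ∃ b', coeffCochain U g n b' = 0 ∧ d U B n b' = d U B n b by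
    obtain ⟨b', hb', hd⟩ := this
    obtain ⟨a', rfl⟩ := exists_coeffCochain_eq U hfg hb'
    exact ⟨a', coeffCochain_injective U hf _ (by rw [hab, ← hd, d_coeffCochain])⟩
  cases n with
  | zero => exact ⟨b, hb, rfl⟩
  | succ n =>
    obtain ⟨e, he⟩ := hb
    obtain ⟨e', rfl⟩ := coeffCochain_surjective U hg _ e
    refine ⟨b - d U B n e', ?_, ?_⟩
    · rw [map_sub, ← he, d_coeffCochain, sub_self]
    · rw [map_sub, d_d, sub_zero]

/-- Exactness in degree one at the coefficients `A`. A `0`-cochain with values in `B` whose image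
is a cocycle can be corrected, without changing its differential, by the cocycle obtained from the
image through a set-theoretic section of `g`: a `0`-cocycle is a global locally constant function,
and these lift. -/
lemma mem_coboundaries_one (U : PointedCover X) {f : A →+ B} {g : B →+ C}
    (hf : Function.Injective f) (hfg : Function.Exact f g) (hg : Function.Surjective g)
    {a : Cochain U A 1} {b : Cochain U B 0} (hab : coeffCochain U f 1 a = d U B 0 b) :
    a ∈ coboundaries U A 1 := by
  have hgb : d U C 0 (coeffCochain U g 0 b) = 0 := by
    rw [d_coeffCochain, ← hab, coeffCochain_comp_eq_zero U hfg]
  let b' : Cochain U B 0 := fun i => (b i).map (Function.surjInv hg ∘ g)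
  have hb' : d U B 0 b' = 0 := by
    funext i
    ext x
    have hx := DFunLike.congr_fun (congrFun hgb i) x
    rw [d_zero_apply] at hx ⊢
    exact sub_eq_zero.2 (congrArg (Function.surjInv hg) (sub_eq_zero.1 hx))
  refine mem_coboundaries_of_coeffCochain_eq_d U hf hfg hg (b := b - b') ?_ ?_
  · rw [hab, map_sub, hb', sub_zero]
  · have : coeffCochain U g 0 (b - b') = 0 := by
      rw [map_sub, sub_eq_zero]
      funext i
      ext x
      exact (Function.surjInv_eq hg _).symm
    rw [this]
    exact zero_mem _

end Cochains

/-! ### Cocycles and their classes in the direct limit -/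

section Limit

variable {X : Type*} [TopologicalSpace X] {A B C : Type*} [AddCommGroup A] [AddCommGroup B]
  [AddCommGroup C]

instance (n : ℕ) : DirectedSystem (fun U : PointedCover X => HCover U A n)
    fun U V h => res A n U V h where
  map_self U x := by
    induction x using QuotientAddGroup.induction_on
    rfl
  map_map U V W h h' x := by
    induction x using QuotientAddGroup.induction_on
    rfl

/-- The restriction of a cocycle to a finer cover. -/
def resCocycle {U V : PointedCover X} (h : U ≤ V) {n : ℕ} (c : cocycles U A n) : cocycles V A n :=
  ⟨resCochain h n c, by
    rw [AddMonoidHom.mem_ker, d_resCochain, AddMonoidHom.mem_ker.1 c.2, map_zero]⟩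

/-- The image of a cocycle under a homomorphism of coefficient groups. -/
def coeffCocycle {U : PointedCover X} (f : A →+ B) {n : ℕ} (c : cocycles U A n) : cocycles U B n :=
  ⟨coeffCochain U f n c, by
    rw [AddMonoidHom.mem_ker, d_coeffCochain, AddMonoidHom.mem_ker.1 c.2, map_zero]⟩

lemma mk_eq_zero_iff {U : PointedCover X} {n : ℕ} {c : cocycles U A n} :
    HCover.mk U A n c = 0 ↔ (c : Cochain U A n) ∈ coboundaries U A n :=
  (QuotientAddGroup.eq_zero_iff c).trans AddSubgroup.mem_addSubgroupOf

lemma exists_cls_eq {n : ℕ} (x : H X A n) :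
    ∃ (U : PointedCover X) (c : cocycles U A n), cls c = x := by
  classical
  induction x using AddCommGroup.DirectLimit.induction_on with
  | ih U y =>
    induction y using QuotientAddGroup.induction_on with
    | H c => exact ⟨U, c, rfl⟩

lemma cls_resCocycle {U V : PointedCover X} (h : U ≤ V) {n : ℕ} (c : cocycles U A n) :
    cls (resCocycle h c) = cls c := by
  classical
  exact AddCommGroup.DirectLimit.of_f (G := fun U : PointedCover X => HCover U A n)
    (f := res A n) h (HCover.mk U A n c)

lemma map_cls (f : A →+ B) {U : PointedCover X} {n : ℕ} (c : cocycles U A n) :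
    map X f n (cls c) = cls (coeffCocycle f c) := by
  classical
  exact AddCommGroup.DirectLimit.map_apply_of (coeff f n) (coeff_comp_res f n) (HCover.mk U A n c)

lemma cls_add {U : PointedCover X} {n : ℕ} (c c' : cocycles U A n) :
    cls (c + c') = cls c + cls c' := by
  simp only [cls, map_add]
  rfl

lemma cls_sub {U : PointedCover X} {n : ℕ} (c c' : cocycles U A n) :
    cls (c - c') = cls c - cls c' := by
  rw [eq_sub_iff_add_eq, ← cls_add, sub_add_cancel]

lemma cls_eq_zero_iff {U : PointedCover X} {n : ℕ} {c : cocycles U A n} :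
    cls c = 0 ↔ ∃ (V : PointedCover X) (h : U ≤ V), resCochain h n c ∈ coboundaries V A n := by
  classical
  constructor
  · intro hc
    obtain ⟨V, h, hV⟩ := AddCommGroup.DirectLimit.of.zero_exact _ _ hc
    exact ⟨V, h, mk_eq_zero_iff (c := resCocycle h c).1 hV⟩
  · rintro ⟨V, h, hV⟩
    rw [← cls_resCocycle h, cls, mk_eq_zero_iff (c := resCocycle h c).2 hV]
    exact map_zero _

lemma cls_eq_zero {U : PointedCover X} {n : ℕ} {c : cocycles U A n}
    (hc : (c : Cochain U A n) ∈ coboundaries U A n) : cls c = 0 :=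
  cls_eq_zero_iff.2 ⟨U, le_rfl, hc⟩

end Limit

/-! ### The connecting homomorphism and the long exact sequence -/

section LongExactSequence

variable {X : Type*} [TopologicalSpace X] {A B C : Type*} [AddCommGroup A] [AddCommGroup B]
  [AddCommGroup C] {f : A →+ B} {g : B →+ C}

/-- Every cocycle with values in `C` has a lift `b` with values in `B`, and `d b` comes from a
cocycle `a` with values in `A`. -/
lemma exists_lift_cocycle (hf : Function.Injective f) (hfg : Function.Exact f g)
    (hg : Function.Surjective g) {n : ℕ} {U : PointedCover X} (c : cocycles U C n) :
    ∃ (b : Cochain U B n) (a : cocycles U A (n + 1)),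
      coeffCochain U g n b = c ∧ coeffCochain U f (n + 1) a = d U B n b := by
  obtain ⟨b, hb⟩ := coeffCochain_surjective U hg n (c : Cochain U C n)
  obtain ⟨a, ha⟩ := exists_coeffCochain_eq U hfg (b := d U B n b) (by
    rw [← d_coeffCochain, hb, AddMonoidHom.mem_ker.1 c.2])
  refine ⟨b, ⟨a, coeffCochain_injective U hf _ ?_⟩, hb, ha⟩
  rw [← d_coeffCochain, ha, d_d, map_zero]

/-- On the cocycles of a cover, the class of `a` does not depend on the choice of the lift `b`, so
that it is additive in the cocycle, kills coboundaries and is compatible with refinement. -/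
theorem exists_isConnectingHom (hf : Function.Injective f) (hfg : Function.Exact f g)
    (hg : Function.Surjective g) (n : ℕ) :
    ∃ δ : H X C n →+ H X A (n + 1), IsConnectingHom f g n δ := by
  classical
  choose b a hb ha using fun (U : PointedCover X) (c : cocycles U C n) =>
    exists_lift_cocycle hf hfg hg c
  let φ (U : PointedCover X) : cocycles U C n →+ H X A (n + 1) :=
    AddMonoidHom.mk' (fun c => cls (a U c)) fun c c' => by
      rw [← cls_add, ← sub_eq_zero, ← cls_sub]
      refine cls_eq_zero (mem_coboundaries_of_coeffCochain_eq_d U hf hfg hg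
        (b := b U (c + c') - (b U c + b U c')) ?_ ?_)
      · simp [ha]
      · simp [hb, zero_mem]
  -- the class computed on `U` from any lift agrees with the chosen one on a finer cover `V`
  have hφ {U V : PointedCover X} (h : U ≤ V) (b' : Cochain U B n) (c : cocycles V C n)
      (a' : cocycles U A (n + 1)) (hc : resCochain h n (coeffCochain U g n b') = c)
      (ha' : coeffCochain U f (n + 1) a' = d U B n b') : φ V c = cls a' := by
    rw [← cls_resCocycle h a', ← sub_eq_zero]
    refine (cls_sub _ _).symm.trans (cls_eq_zero (mem_coboundaries_of_coeffCochain_eq_d V hf hfg hg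
      (b := b V c - resCochain h n b') ?_ ?_))
    · rw [map_sub, d_resCochain, ← ha', ← ha, ← coeffCochain_resCochain, ← map_sub]
      rfl
    · rw [map_sub, coeffCochain_resCochain, hc, hb, sub_self]
      exact zero_mem _
  let ψ (U : PointedCover X) : HCover U C n →+ H X A (n + 1) :=
    QuotientAddGroup.lift _ (φ U) fun c hc =>
      cls_eq_zero (mem_coboundaries_of_coeffCochain_eq_d U hf hfg hg (ha U c)
        (by rw [hb]; exact AddSubgroup.mem_addSubgroupOf.1 hc))
  have hψ (U V : PointedCover X) (h : U ≤ V) (x : HCover U C n) :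
      ψ V (res C n U V h x) = ψ U x := by
    induction x using QuotientAddGroup.induction_on with
    | H c => exact hφ h (b U c) (resCocycle h c) (a U c) (by rw [hb]; rfl) (ha U c)
  refine ⟨AddCommGroup.DirectLimit.lift _ _ _ ψ hψ, fun U b' c a' hc ha' => ?_⟩
  exact (AddCommGroup.DirectLimit.lift_of _ ψ hψ U (HCover.mk U C n c)).trans
    (hφ le_rfl b' c a' hc ha')

theorem IsConnectingHom.unique (hf : Function.Injective f) (hfg : Function.Exact f g)
    (hg : Function.Surjective g) {n : ℕ} {δ δ' : H X C n →+ H X A (n + 1)}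
    (hδ : IsConnectingHom f g n δ) (hδ' : IsConnectingHom f g n δ') : δ' = δ := by
  ext x
  obtain ⟨U, c, rfl⟩ := exists_cls_eq x
  obtain ⟨b, a, hb, ha⟩ := exists_lift_cocycle hf hfg hg c
  rw [hδ U b c a hb ha, hδ' U b c a hb ha]

/-- Injectivity in degree one holds because `Ȟ⁰(X; B) → Ȟ⁰(X; C)` is surjective. -/
theorem map_one_injective (hf : Function.Injective f) (hfg : Function.Exact f g)
    (hg : Function.Surjective g) : Function.Injective (map X f 1) := by
  rw [injective_iff_map_eq_zero]
  intro x hx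
  obtain ⟨U, a, rfl⟩ := exists_cls_eq x
  rw [map_cls, cls_eq_zero_iff] at hx
  obtain ⟨V, h, b, hb⟩ := hx
  exact cls_eq_zero_iff.2 ⟨V, h, mem_coboundaries_one V hf hfg hg (b := b) hb.symm⟩

theorem exact_map_map (hf : Function.Injective f) (hfg : Function.Exact f g)
    (hg : Function.Surjective g) (n : ℕ) :
    Function.Exact (map X f (n + 1)) (map X g (n + 1)) := by
  intro y
  constructor
  · intro hy
    obtain ⟨U, b, rfl⟩ := exists_cls_eq y
    rw [map_cls, cls_eq_zero_iff] at hy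
    obtain ⟨V, h, e, he⟩ := hy
    obtain ⟨e, rfl⟩ := coeffCochain_surjective V hg _ e
    -- on a finer cover `g b = d (g e)`, so the cocycle `b - d e` comes from `A`
    obtain ⟨a, ha⟩ := exists_coeffCochain_eq V hfg (b := resCochain h (n + 1) b - d V B n e) (by
      rw [map_sub, ← d_coeffCochain, he, sub_eq_zero]
      rfl)
    have hda : a ∈ cocycles V A (n + 1) := by
      apply coeffCochain_injective V hf
      rw [← d_coeffCochain, ha, map_sub, d_d, d_resCochain, AddMonoidHom.mem_ker.1 b.2]
      simp
    refine ⟨cls ⟨a, hda⟩, ?_⟩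
    rw [map_cls, ← cls_resCocycle h b, ← sub_eq_zero, ← cls_sub]
    refine cls_eq_zero ⟨-e, ?_⟩
    change _ = coeffCochain V f (n + 1) a - resCochain h (n + 1) b
    rw [ha, map_neg]
    abel
  · rintro ⟨x, rfl⟩
    obtain ⟨U, a, rfl⟩ := exists_cls_eq x
    rw [map_cls, map_cls]
    refine cls_eq_zero ?_
    change coeffCochain U g (n + 1) (coeffCochain U f (n + 1) a) ∈ _
    rw [coeffCochain_comp_eq_zero U hfg]
    exact zero_mem _

theorem IsConnectingHom.exact_map_right (hf : Function.Injective f) (hfg : Function.Exact f g)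
    (hg : Function.Surjective g) {n : ℕ} {δ : H X C n →+ H X A (n + 1)}
    (hδ : IsConnectingHom f g n δ) : Function.Exact (map X g n) δ := by
  intro z
  constructor
  · intro hz
    obtain ⟨U, c, rfl⟩ := exists_cls_eq z
    obtain ⟨b, a, hb, ha⟩ := exists_lift_cocycle hf hfg hg c
    rw [hδ U b c a hb ha, cls_eq_zero_iff] at hz
    obtain ⟨V, h, a', ha'⟩ := hz
    -- on a finer cover `a = d a'`, so `b - f a'` is a cocycle; it still maps to `c`
    have hcoc : resCochain h n b - coeffCochain V f n a' ∈ cocycles V B n := by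
      rw [AddMonoidHom.mem_ker, map_sub, d_resCochain, d_coeffCochain, ha', ← ha,
        coeffCochain_resCochain, sub_self]
    refine ⟨cls ⟨_, hcoc⟩, ?_⟩
    rw [map_cls, ← cls_resCocycle h c]
    congr 1
    apply Subtype.ext
    change coeffCochain V g n (_ - _) = resCochain h n c
    rw [map_sub, coeffCochain_comp_eq_zero V hfg, sub_zero, coeffCochain_resCochain, hb]
  · rintro ⟨y, rfl⟩
    obtain ⟨U, b, rfl⟩ := exists_cls_eq y
    rw [map_cls, hδ U b (coeffCocycle g b) 0 rfl
      ((map_zero _).trans (AddMonoidHom.mem_ker.1 b.2).symm)]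
    exact cls_eq_zero (zero_mem _)

theorem IsConnectingHom.exact_map_left (hf : Function.Injective f) (hfg : Function.Exact f g)
    (hg : Function.Surjective g) {n : ℕ} {δ : H X C n →+ H X A (n + 1)}
    (hδ : IsConnectingHom f g n δ) : Function.Exact δ (map X f (n + 1)) := by
  intro x
  constructor
  · intro hx
    obtain ⟨U, a, rfl⟩ := exists_cls_eq x
    rw [map_cls, cls_eq_zero_iff] at hx
    obtain ⟨V, h, b, hb⟩ := hx
    have hcoc : coeffCochain V g n b ∈ cocycles V C n := by
      rw [AddMonoidHom.mem_ker, d_coeffCochain, hb]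
      exact coeffCochain_comp_eq_zero V hfg (resCochain h (n + 1) a)
    exact ⟨cls ⟨_, hcoc⟩,
      (hδ V b ⟨_, hcoc⟩ (resCocycle h a) rfl hb.symm).trans (cls_resCocycle h a)⟩
  · rintro ⟨z, rfl⟩
    obtain ⟨U, c, rfl⟩ := exists_cls_eq z
    obtain ⟨b, a, hb, ha⟩ := exists_lift_cocycle hf hfg hg c
    rw [hδ U b c a hb ha, map_cls]
    exact cls_eq_zero ⟨b, ha.symm⟩

lemma map_comp_apply (f : A →+ B) (g : B →+ C) (n : ℕ) (x : H X A n) :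
    map X (g.comp f) n x = map X g n (map X f n x) := by
  obtain ⟨U, c, rfl⟩ := exists_cls_eq x
  rw [map_cls, map_cls, map_cls]
  rfl

/-- Composing the homomorphism of coefficients with one that has a left inverse does not change
the kernel in cohomology. -/
lemma ker_map_comp (f : A →+ B) {g : B →+ C} {g' : C →+ B} (h : g'.comp g = AddMonoidHom.id B)
    (n : ℕ) : (map X (g.comp f) n).ker = (map X f n).ker := by
  ext x
  rw [AddMonoidHom.mem_ker, AddMonoidHom.mem_ker, map_comp_apply]
  refine ⟨fun hx => ?_, fun hx => by rw [hx, map_zero]⟩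
  rw [← AddMonoidHom.id_comp f, ← h, AddMonoidHom.comp_assoc, map_comp_apply, map_comp_apply, hx,
    map_zero]

end LongExactSequence

end Cech

/-! ### The exponential sequence -/

lemma twoPiInt_injective : Function.Injective twoPiInt := fun k l h => by
  have h' : 2 * Real.pi * (k : ℝ) = 2 * Real.pi * l := h
  exact_mod_cast mul_left_cancel₀ Real.two_pi_pos.ne' h'

lemma exact_twoPiInt_expHom : Function.Exact twoPiInt Circle.expHom := fun r => by
  have h : Circle.expHom r = 0 ↔ Circle.exp r = 1 := Iff.rfl
  rw [h, Circle.exp_eq_one]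
  exact exists_congr fun k => by rw [eq_comm, mul_comm]; rfl

lemma expHom_surjective : Function.Surjective Circle.expHom := Circle.exp_surjective

lemma twoPiInt_eq_mulLeft_comp :
    twoPiInt = (AddMonoidHom.mulLeft (2 * Real.pi)).comp (Int.castAddHom ℝ) := rfl

lemma mulLeft_inv_comp_mulLeft {r : ℝ} (hr : r ≠ 0) :
    (AddMonoidHom.mulLeft r⁻¹).comp (AddMonoidHom.mulLeft r) = AddMonoidHom.id ℝ :=
  AddMonoidHom.ext fun x => inv_mul_cancel_left₀ hr x

theorem mainTheorem4 (M : Type*) [TopologicalSpace M] :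
    -- the sequence `0 → ℤ → ℝ → S¹ → 1`, `k ↦ 2πk`, `a ↦ exp (i a)`, is exact
    (Function.Injective twoPiInt ∧ Function.Exact twoPiInt Circle.expHom ∧
      Function.Surjective Circle.expHom) ∧
    -- the kernel in degree 2 is also that of the map induced by the inclusion `k ↦ k`
    (Cech.map M twoPiInt 2).ker = (Cech.map M (Int.castAddHom ℝ) 2).ker ∧
    -- the connecting homomorphism exists, is unique, and fits into the long exact sequence
    ∃ δ : Cech.H M (Additive Circle) 1 →+ Cech.H M ℤ 2,
      Cech.IsConnectingHom twoPiInt Circle.expHom 1 δ ∧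
      (∀ δ' : Cech.H M (Additive Circle) 1 →+ Cech.H M ℤ 2,
        Cech.IsConnectingHom twoPiInt Circle.expHom 1 δ' → δ' = δ) ∧
      Function.Injective (Cech.map M twoPiInt 1) ∧
      Function.Exact (Cech.map M twoPiInt 1) (Cech.map M Circle.expHom 1) ∧
      Function.Exact (Cech.map M Circle.expHom 1) δ ∧
      Function.Exact δ (Cech.map M twoPiInt 2) ∧
      -- the short exact sequence, whose maps are induced by `exp` and by `δ`
      ∃ (e : (Cech.H M ℝ 1 ⧸ (Cech.map M twoPiInt 1).range) →+ Cech.H M (Additive Circle) 1)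
        (q : Cech.H M (Additive Circle) 1 →+ (Cech.map M twoPiInt 2).ker),
        (∀ x : Cech.H M ℝ 1, e (QuotientAddGroup.mk x) = Cech.map M Circle.expHom 1 x) ∧
        (∀ y : Cech.H M (Additive Circle) 1, (q y : Cech.H M ℤ 2) = δ y) ∧
        Function.Injective e ∧ Function.Exact e q ∧ Function.Surjective q := by
  have hf := twoPiInt_injective
  have hfg := exact_twoPiInt_expHom
  have hg := expHom_surjective
  obtain ⟨δ, hδ⟩ := Cech.exists_isConnectingHom (X := M) hf hfg hg 1
  have h₁ := Cech.exact_map_map (X := M) hf hfg hg 0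
  have h₂ := hδ.exact_map_right hf hfg hg
  have h₃ := hδ.exact_map_left hf hfg hg
  refine ⟨⟨hf, hfg, hg⟩, ?_, δ, hδ, fun δ' hδ' => hδ.unique hf hfg hg hδ',
    Cech.map_one_injective hf hfg hg, h₁, h₂, h₃, ?_⟩
  · rw [twoPiInt_eq_mulLeft_comp,
      Cech.ker_map_comp _ (mulLeft_inv_comp_mulLeft Real.two_pi_pos.ne')]
  let e := QuotientAddGroup.lift (Cech.map M twoPiInt 1).range (Cech.map M Circle.expHom 1)
    fun x hx => (h₁ x).2 hx
  let q := δ.codRestrict (Cech.map M twoPiInt 2).ker fun y => h₃.apply_apply_eq_zero y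
  refine ⟨e, q, fun _ => rfl, fun _ => rfl, ?_, ?_, ?_⟩
  · rw [injective_iff_map_eq_zero]
    intro x hx
    induction x using QuotientAddGroup.induction_on with
    | H x => exact (QuotientAddGroup.eq_zero_iff x).2 ((h₁ x).1 hx)
  · intro y
    rw [← Subtype.coe_inj]
    refine (h₂ y).trans ⟨fun ⟨x, hx⟩ => ⟨QuotientAddGroup.mk x, hx⟩, ?_⟩
    rintro ⟨x, hx⟩
    induction x using QuotientAddGroup.induction_on with
    | H x => exact ⟨x, hx⟩
  · rintro ⟨x, hx⟩
    obtain ⟨y, hy⟩ := (h₃ x).1 hx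
    exact ⟨y, Subtype.ext hy⟩
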